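/- Throughout, fix algebraic closures $\overline{\mathbb Q}$, $\overline{\mathbb Q}_\ell$ and $\overline{\mathbb F}_\ell$ of $\mathbb{Q}$, $\mathbb{Q}_\ell$ and $\mathbb{F}_\ell$, and an embedding $\overline{\mathbb Q}\hookrightarrow\overline{\mathbb Q}_\ell$, through which $G_{\mathbb Q_\ell}$ maps to $G_{\mathbb Q}$. A Galois representation is a continuous homomorphism to $\mathrm{GL}_m(\overline{\mathbb F}_\ell)$, where $\overline{\mathbb F}_\ell$ has the discrete topology. Let $I_\ell\subseteq G_{\mathbb Q_\ell}$ be the inertia group and, for each $r\ge 1$, let $\psi_r: I_\ell\to\overline{\mathbb F}_\ell^\times$ be a fixed fundamental character of niveau $r$: the character $\sigma\mapsto \sigma(\varpi)/\varpi$ modulo the maximal ideal, where $\varpi^{\ell^r-1}=\ell$, composed with an embedding of the residue field of $\overline{\mathbb Q}_\ell$ into $\overline{\mathbb F}_\ell$. Definition. Let $V$ be an $n$-dimensional vector space over $\overline{\mathbb F}_\ell$. A representation $\rho:G_{\mathbb Q_\ell}\to \mathrm{GL}(V)$ is *regular* if there are an integer $s$ with $1\le s\le n$ and non-empty sets $S_i=\{a_{i,1},\dots,a_{i,r_i}\}\subseteq\{0,\dots,\ell-1\}$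 with $|S_i|=r_i$ ($i=1,\dots,s$) and $r_1+\dots+r_s=n$, such that $S=S_1\cup\dots\cup S_s$ has $n$ elements (all the $a_{i,j}$ are distinct) and such that, in a suitable basis of $V$, $\rho|_{I_\ell}$ is block upper triangular with diagonal blocks $B_1,\dots,B_s$, where $$B_i=\mathrm{diag}\bigl(\psi_{r_i}^{b_i},\psi_{r_i}^{b_i\ell},\dots,\psi_{r_i}^{b_i\ell^{r_i-1}}\bigr),\qquad b_i=a_{i,1}+a_{i,2}\ell+\dots+a_{i,r_i}\ell^{r_i-1}.$$ The elements of $S$ are called *tame inertia weights* of $\rho$, and $\rho$ is *regular with tame inertia weights at most $k$* if this holds for some such $S\subseteq\{0,1,\dots,k\}$. A representation of $G_{\mathbb Q}$ is said to have this property if its restriction to $G_{\mathbb Q_\ell}$ has it. Proposition 3.4. Let $n,m,k$ be natural numbers, let $a\in\mathbb Z$, and let $\ell>k\cdot n!+1$ be a prime. Let $K/\mathbb Q$ be a finite extension inside $\overline{\mathbb Q}$ with $[K:\mathbb Q]\cdot m=n$, let $\rho:G_K\to\mathrm{GL}_m(\overline{\mathbb F}_\ell)$ be a Galois representation, and let $\beta=\mathrm{Ind}_{G_K}^{G_{\mathbb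 Q}}\rho$. Let $\chi_\ell$ be the mod $\ell$ cyclotomic character. If $\chi_\ell^a\otimes\beta$ is regular with tame inertia weights at most $k$, then $K/\mathbb Q$ is unramified at $\ell$. -/

import Mathlib

noncomputable section

namespace RegularGalois

/-- `AlgebraicClosure ℚ`, with the canonical `ℚ`-algebra structure that every field of
characteristic zero carries, is an algebraic closure of `ℚ`. -/
instance : IsAlgClosure ℚ (AlgebraicClosure ℚ) := by
  have h : (AlgebraicClosure.instAlgebra ℚ : Algebra ℚ (AlgebraicClosure ℚ)) =
      DivisionRing.toRatAlgebra := Subsingleton.elim _ _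
  exact h ▸ AlgebraicClosure.instIsAlgClosure ℚ

/-- The absolute Galois group of `ℚ`, with its Krull topology. -/
abbrev GQ : Type := Gal(AlgebraicClosure ℚ/ℚ)

/-- The absolute Galois group of `ℚ_ℓ`, with its Krull topology. -/
abbrev GQl (ℓ : ℕ) [Fact ℓ.Prime] : Type := Gal(PadicAlgCl ℓ/ℚ_[ℓ])

/-- `𝔽̄_ℓ`, an algebraic closure of the field with `ℓ` elements. -/
abbrev Fbar (ℓ : ℕ) [Fact ℓ.Prime] : Type := AlgebraicClosure (ZMod ℓ)

/-- The ring of integers of the algebraic closure of `ℚ_ℓ`. -/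
abbrev Zbar (ℓ : ℕ) [Fact ℓ.Prime] : ValuationSubring (PadicAlgCl ℓ) :=
  (Valued.v (R := PadicAlgCl ℓ)).valuationSubring

/-- The restriction map `G_{ℚ_ℓ} → G_ℚ` attached to an embedding of `ℚ̄` into `ℚ̄_ℓ`. -/
def restrictGQ (ℓ : ℕ) [Fact ℓ.Prime] (j : AlgebraicClosure ℚ →+* PadicAlgCl ℓ) :
    GQl ℓ →* GQ :=
  letI : Algebra (AlgebraicClosure ℚ) (PadicAlgCl ℓ) := j.toAlgebra
  haveI : IsScalarTower ℚ (AlgebraicClosure ℚ) (PadicAlgCl ℓ) :=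
    IsScalarTower.of_algebraMap_eq fun q => by simp
  (AlgEquiv.restrictNormalHom (AlgebraicClosure ℚ)).comp (AlgEquiv.restrictScalarsHom ℚ)

/-- The defining property of the restriction map: it is compatible with the embedding. -/
theorem restrictGQ_spec (ℓ : ℕ) [Fact ℓ.Prime] (j : AlgebraicClosure ℚ →+* PadicAlgCl ℓ)
    (σ : GQl ℓ) (x : AlgebraicClosure ℚ) : j (restrictGQ ℓ j σ x) = σ (j x) := by
  let : Algebra (AlgebraicClosure ℚ) (PadicAlgCl ℓ) := j.toAlgebra
  have : IsScalarTower ℚ (AlgebraicClosure ℚ) (PadicAlgCl ℓ) :=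
    IsScalarTower.of_algebraMap_eq fun q => by simp
  exact AlgEquiv.restrictNormal_commutes (σ.restrictScalars ℚ) (AlgebraicClosure ℚ) x

/-- The inertia group `I_ℓ ⊆ G_{ℚ_ℓ}`: the automorphisms which preserve the ring of integers of
`ℚ̄_ℓ` (all of them do) and act trivially on its residue field. -/
def inertia (ℓ : ℕ) [Fact ℓ.Prime] : Subgroup (GQl ℓ) :=
  ((Zbar ℓ).inertiaSubgroup ℚ_[ℓ]).map ((Zbar ℓ).decompositionSubgroup ℚ_[ℓ]).subtype

theorem exists_of_mem_inertia {ℓ : ℕ} [Fact ℓ.Prime] {σ : GQl ℓ} (hσ : σ ∈ inertia ℓ)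
    (x : Zbar ℓ) : ∃ h : σ x ∈ Zbar ℓ,
      IsLocalRing.residue (Zbar ℓ) ⟨σ x, h⟩ = IsLocalRing.residue (Zbar ℓ) x := by
  obtain ⟨τ, hτ, rfl⟩ := hσ
  refine ⟨(τ • x).2, ?_⟩
  have h := DFunLike.congr_fun (MonoidHom.mem_ker.mp hτ) (IsLocalRing.residue (Zbar ℓ) x)
  exact h

theorem exists_root (ℓ : ℕ) [Fact ℓ.Prime] (r : ℕ+) :
    ∃ x : PadicAlgCl ℓ, x ^ (ℓ ^ (r : ℕ) - 1) = (ℓ : PadicAlgCl ℓ) :=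
  IsAlgClosed.exists_pow_nat_eq _
    (Nat.sub_pos_of_lt (Nat.one_lt_pow r.ne_zero (Fact.out : ℓ.Prime).one_lt))

/-- A fixed `(ℓ^r - 1)`-th root of `ℓ` in `ℚ̄_ℓ`. -/
def rootOfEll (ℓ : ℕ) [Fact ℓ.Prime] (r : ℕ+) : PadicAlgCl ℓ := (exists_root ℓ r).choose

theorem rootOfEll_pow (ℓ : ℕ) [Fact ℓ.Prime] (r : ℕ+) :
    rootOfEll ℓ r ^ (ℓ ^ (r : ℕ) - 1) = (ℓ : PadicAlgCl ℓ) := (exists_root ℓ r).choose_spec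

theorem pow_sub_one_ne_zero (ℓ : ℕ) [Fact ℓ.Prime] (r : ℕ+) : ℓ ^ (r : ℕ) - 1 ≠ 0 :=
  (Nat.sub_pos_of_lt (Nat.one_lt_pow r.ne_zero (Fact.out : ℓ.Prime).one_lt)).ne'

theorem rootOfEll_ne_zero (ℓ : ℕ) [Fact ℓ.Prime] (r : ℕ+) : rootOfEll ℓ r ≠ 0 := by
  intro h
  have h1 := rootOfEll_pow ℓ r
  rw [h, zero_pow (pow_sub_one_ne_zero ℓ r)] at h1
  exact (Fact.out : ℓ.Prime).ne_zero (by exact_mod_cast h1.symm)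

theorem apply_root_div_pow (ℓ : ℕ) [Fact ℓ.Prime] (r : ℕ+) (σ : GQl ℓ) :
    (σ (rootOfEll ℓ r) / rootOfEll ℓ r) ^ (ℓ ^ (r : ℕ) - 1) = 1 := by
  rw [div_pow, ← map_pow, rootOfEll_pow, map_natCast, div_self]
  exact_mod_cast (Fact.out : ℓ.Prime).ne_zero

/-- The integral element `σ(ϖ)/ϖ`, where `ϖ` is an `(ℓ^r - 1)`-th root of `ℓ`. -/
def rootQuotient (ℓ : ℕ) [Fact ℓ.Prime] (r : ℕ+) (σ : GQl ℓ) : Zbar ℓ :=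
  ⟨σ (rootOfEll ℓ r) / rootOfEll ℓ r, by
    have h := congrArg (Valued.v (R := PadicAlgCl ℓ)) (apply_root_div_pow ℓ r σ)
    rw [map_pow, map_one] at h
    exact ((pow_eq_one_iff_of_nonneg zero_le (pow_sub_one_ne_zero ℓ r)).mp h).le⟩

/-- The fundamental character `ψ_r : I_ℓ → 𝔽̄_ℓˣ` of niveau `r`: the character
`σ ↦ σ(ϖ)/ϖ mod 𝔪`, with `ϖ^(ℓ^r - 1) = ℓ`, which has values in the copy of `𝔽_{ℓ^r}ˣ` in the
residue field of `ℚ̄_ℓ`, followed by a field embedding `ι` into `𝔽̄_ℓ`. The fundamental characters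
of niveau `r` are the characters obtained from the various `ι`. -/
def fundamentalCharacter (ℓ : ℕ) [Fact ℓ.Prime] (r : ℕ+)
    (ι : IsLocalRing.ResidueField (Zbar ℓ) →+* Fbar ℓ) : inertia ℓ →* (Fbar ℓ)ˣ :=
  MonoidHom.toHomUnits
    { toFun := fun σ => ι (IsLocalRing.residue (Zbar ℓ) (rootQuotient ℓ r σ))
      map_one' := by
        have : rootQuotient ℓ r (1 : GQl ℓ) = 1 :=
          Subtype.ext (by simp [rootQuotient, rootOfEll_ne_zero])
        simp [this]
      map_mul' := fun σ τ => by
        obtain ⟨h, hres⟩ := exists_of_mem_inertia σ.2 (rootQuotient ℓ r τ)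
        have : rootQuotient ℓ r ((σ * τ : inertia ℓ) : GQl ℓ) =
            rootQuotient ℓ r σ * ⟨_, h⟩ := by
          refine Subtype.ext ?_
          have h0 := rootOfEll_ne_zero ℓ r
          have h1 : (σ : GQl ℓ) (rootOfEll ℓ r) ≠ 0 := by simpa using h0
          change (σ : GQl ℓ) ((τ : GQl ℓ) (rootOfEll ℓ r)) / rootOfEll ℓ r =
            (σ : GQl ℓ) (rootOfEll ℓ r) / rootOfEll ℓ r *
              (σ : GQl ℓ) ((τ : GQl ℓ) (rootOfEll ℓ r) / rootOfEll ℓ r)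
          rw [map_div₀]
          field_simp
        rw [this, map_mul, map_mul, hres] }

section Regular

variable (ℓ : ℕ) [Fact ℓ.Prime]
  (ι : ℕ+ → (IsLocalRing.ResidueField (Zbar ℓ) →+* Fbar ℓ))
  {V : Type*} [AddCommGroup V] [Module (Fbar ℓ) V]

/-- `ρ : G_{ℚ_ℓ} → GL(V)` is regular and `S` is its set of tame inertia weights (with respect to
the choice of one fundamental character `ψ_r` of each niveau `r ≥ 1` that is given by `ι`).
There are `s ≥ 1` blocks, of sizes `r i ≥ 1`; the set `S_i` consists of the digits `a i j < ℓ`; all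
the digits are distinct and `S` is the set of all of them; and on the inertia group `ρ` is, in a
basis `b` of `V`, block upper triangular with `i`-th diagonal block equal to
`diag(ψ_{r i}^(b_i), ψ_{r i}^(b_i ℓ), …, ψ_{r i}^(b_i ℓ^(r i - 1)))`, where
`b_i = a i 0 + (a i 1) ℓ + ⋯`. The block sizes add up to `dim V`, as they index the basis `b`. -/
def IsRegularWithWeights (ρ : Representation (Fbar ℓ) (GQl ℓ) V) (S : Finset ℕ) : Prop :=
  ∃ (s : ℕ) (r : Fin s → ℕ+) (a : (i : Fin s) → Fin (r i) → ℕ)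
    (b : Module.Basis ((i : Fin s) × Fin (r i)) (Fbar ℓ) V),
    1 ≤ s ∧
    (∀ i j, a i j < ℓ) ∧
    Function.Injective (fun p : (i : Fin s) × Fin (r i) => a p.1 p.2) ∧
    (S : Set ℕ) = Set.range (fun p : (i : Fin s) × Fin (r i) => a p.1 p.2) ∧
    ∀ σ : inertia ℓ,
      (LinearMap.toMatrix b b (ρ (σ : GQl ℓ))).BlockTriangular Sigma.fst ∧
      ∀ i : Fin s,
        Matrix.of (fun j j' : Fin (r i) => LinearMap.toMatrix b b (ρ (σ : GQl ℓ)) ⟨i, j⟩ ⟨i, j'⟩) =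
          Matrix.diagonal fun j : Fin (r i) =>
            ((fundamentalCharacter ℓ (r i) (ι (r i)) σ : (Fbar ℓ)ˣ) : Fbar ℓ) ^
              ((∑ t : Fin (r i), a i t * ℓ ^ (t : ℕ)) * ℓ ^ (j : ℕ))

/-- `ρ : G_{ℚ_ℓ} → GL(V)` is regular with tame inertia weights at most `k`. -/
def IsRegularWithWeightsAtMost (ρ : Representation (Fbar ℓ) (GQl ℓ) V) (k : ℕ) : Prop :=
  ∃ S : Finset ℕ, IsRegularWithWeights ℓ ι ρ S ∧ ∀ w ∈ S, w ≤ k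

/-- A representation of `G_ℚ` is regular with tame inertia weights at most `k` if its restriction
to `G_{ℚ_ℓ}` is (with respect to an embedding `j` of `ℚ̄` into `ℚ̄_ℓ`). -/
def IsGlobalRegularWithWeightsAtMost (j : AlgebraicClosure ℚ →+* PadicAlgCl ℓ)
    (ρ : Representation (Fbar ℓ) GQ V) (k : ℕ) : Prop :=
  IsRegularWithWeightsAtMost ℓ ι (ρ.comp (restrictGQ ℓ j)) k

/-- The mod `ℓ` cyclotomic character of `G_ℚ`, with values in `𝔽̄_ℓˣ`. -/
def cyclo : GQ →* (Fbar ℓ)ˣ :=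
  (Units.map ((algebraMap (ZMod ℓ) (Fbar ℓ)).comp (PadicInt.toZMod (p := ℓ))).toMonoidHom).comp
    ((cyclotomicCharacter (AlgebraicClosure ℚ) ℓ).comp
      (MulSemiringAction.toRingAut GQ (AlgebraicClosure ℚ)))

variable {ℓ}

/-- The twist `χ ⊗ ρ` of a representation by a character. -/
def twist {G : Type*} [Group G] (χ : G →* (Fbar ℓ)ˣ) (ρ : Representation (Fbar ℓ) G V) :
    Representation (Fbar ℓ) G V where
  toFun g := ((χ g : (Fbar ℓ)ˣ) : Fbar ℓ) • ρ g
  map_one' := by simp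
  map_mul' g h := by simp [smul_smul, mul_comm]

/-- The representation on column vectors given by a homomorphism to `GL_m(𝔽̄_ℓ)`. -/
def toRep {G : Type*} [Group G] {m : ℕ} (ρ : G →* GL (Fin m) (Fbar ℓ)) :
    Representation (Fbar ℓ) G (Fin m → Fbar ℓ) :=
  (Matrix.toLinAlgEquiv' (R := Fbar ℓ) (n := Fin m)).toAlgHom.toMonoidHom'.comp
    ((Units.coeHom _).comp ρ)

end Regular

end RegularGalois

end

/-! ### Galois action on residues, and the value group of the fixed field of inertia. -/

noncomputable section

open scoped Pointwise

namespace RegularGalois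

variable {ℓ : ℕ} [Fact ℓ.Prime]

/-! Put `H = G_K`. Elements of `G_ℚ` permute the components of the induced representation like the
cosets of `H`, and a twist only rescales. Since `H` has index at most `n`, the power `σ ^ n!`
preserves every component. If the eigenspaces of `σ ^ n!` are at most one-dimensional, an
eigenvector `w` in a component is also an eigenvector of `σ`, which commutes with `σ ^ n!`. As `σ w`
is a nonzero multiple of `w`, `σ` preserves that component. So `σ` fixes all cosets
(`conj_mem_of_eigenspace_le_one`).

Regularity supplies the eigenspace condition. Choose `R` divisible by all block sizes and `σ` in
inertia with `ψ_R(σ)` of order `ℓ^R - 1`. The eigenvalues of `σ ^ n!` are powers of `ψ_R(σ)`, whose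
exponents modulo `ℓ^R - 1` have base `ℓ` digits `n! * a i j`. The bound on `ℓ` makes these smaller
than `ℓ - 1`, so there are no carries and distinct weights give distinct eigenvalues
(`injective_fundamentalCharacter_pow`). Only the diagonal matters, so wild inertia needs no separate
treatment. The elements with `ψ_R` equal to `ψ_R(σ)`, `σ` among them, generate inertia, so all of
inertia fixes the cosets.

Two points rest on one local fact, `norm_le_inv_of_fixed_by_inertia`: elements fixed by inertia have
no norms strictly between `1/ℓ` and `1`. It makes `ψ_R` surjective onto the roots of unity of order
dividing `ℓ^R - 1`, and it turns triviality of inertia on the conjugates of `K` into ramification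
index one. -/

theorem mem_Zbar_iff {x : PadicAlgCl ℓ} : x ∈ Zbar ℓ ↔ ‖x‖ ≤ 1 := by
  rw [Valuation.mem_valuationSubring_iff, ← PadicAlgCl.valuation_coe, NNReal.coe_le_one]

theorem norm_coe_Zbar_le_one (x : Zbar ℓ) : ‖(x : PadicAlgCl ℓ)‖ ≤ 1 := mem_Zbar_iff.mp x.2

theorem norm_galois_apply (σ : GQl ℓ) (x : PadicAlgCl ℓ) : ‖σ x‖ = ‖x‖ :=
  (spectralNorm_eq_of_equiv σ x).symm

theorem galois_apply_mem_Zbar (σ : GQl ℓ) {x : PadicAlgCl ℓ} (hx : x ∈ Zbar ℓ) : σ x ∈ Zbar ℓ :=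
  mem_Zbar_iff.mpr ((norm_galois_apply σ x).trans_le (mem_Zbar_iff.mp hx))

theorem norm_natCast_prime : ‖(ℓ : PadicAlgCl ℓ)‖ = (ℓ : ℝ)⁻¹ := by
  rw [← PadicAlgCl.valuation_coe, PadicAlgCl.valuation_p]
  simp

theorem mem_maximalIdeal_Zbar_iff (x : Zbar ℓ) :
    x ∈ IsLocalRing.maximalIdeal (Zbar ℓ) ↔ ‖(x : PadicAlgCl ℓ)‖ < 1 := by
  have hx := norm_coe_Zbar_le_one x
  rw [IsLocalRing.mem_maximalIdeal, mem_nonunits_iff]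
  constructor
  · intro h
    refine lt_of_le_of_ne hx fun h1 => h ?_
    have h0 : (x : PadicAlgCl ℓ) ≠ 0 := by
      intro h0
      rw [h0, norm_zero] at h1
      exact zero_ne_one h1
    have hinv : (x : PadicAlgCl ℓ)⁻¹ ∈ Zbar ℓ :=
      mem_Zbar_iff.mpr (by rw [norm_inv, h1, inv_one])
    have hmul : x * ⟨(x : PadicAlgCl ℓ)⁻¹, hinv⟩ = 1 := Subtype.ext (mul_inv_cancel₀ h0)
    exact IsUnit.of_mul_eq_one _ hmul
  · rintro h ⟨u, rfl⟩
    have h1 : ‖((u : Zbar ℓ) : PadicAlgCl ℓ)‖ * ‖((↑u⁻¹ : Zbar ℓ) : PadicAlgCl ℓ)‖ = 1 := by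
      have h2 : ((u : Zbar ℓ) : PadicAlgCl ℓ) * ((↑u⁻¹ : Zbar ℓ) : PadicAlgCl ℓ) = 1 :=
        congrArg Subtype.val u.mul_inv
      rw [← norm_mul, h2, norm_one]
    have h2 := norm_coe_Zbar_le_one (↑u⁻¹ : Zbar ℓ)
    have h3 := norm_nonneg ((u : Zbar ℓ) : PadicAlgCl ℓ)
    nlinarith

theorem residue_eq_iff (x y : Zbar ℓ) :
    IsLocalRing.residue (Zbar ℓ) x = IsLocalRing.residue (Zbar ℓ) y ↔
      ‖(x : PadicAlgCl ℓ) - y‖ < 1 := by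
  have h := mem_maximalIdeal_Zbar_iff (x - y)
  rw [← IsLocalRing.residue_eq_zero_iff, map_sub, sub_eq_zero] at h
  exact h

theorem mem_inertia_iff {σ : GQl ℓ} :
    σ ∈ inertia ℓ ↔ ∀ x : PadicAlgCl ℓ, ‖x‖ ≤ 1 → ‖σ x - x‖ < 1 := by
  constructor
  · intro h x hx
    lift x to Zbar ℓ using mem_Zbar_iff.mpr hx
    obtain ⟨h', hres⟩ := exists_of_mem_inertia h x
    exact (residue_eq_iff ⟨σ x, h'⟩ x).mp hres
  · intro h
    have hσ : σ ∈ (Zbar ℓ).decompositionSubgroup ℚ_[ℓ] := by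
      rw [MulAction.mem_stabilizer_iff]
      ext x
      rw [ValuationSubring.mem_smul_pointwise_iff_exists]
      constructor
      · rintro ⟨y, hy, rfl⟩
        exact galois_apply_mem_Zbar σ hy
      · intro hx
        exact ⟨σ⁻¹ x, galois_apply_mem_Zbar σ⁻¹ hx, AlgEquiv.apply_symm_apply σ x⟩
    refine ⟨⟨σ, hσ⟩, ?_, rfl⟩
    refine MonoidHom.mem_ker.mpr (RingEquiv.ext fun z => ?_)
    obtain ⟨x, rfl⟩ := IsLocalRing.residue_surjective z
    exact (residue_eq_iff ⟨σ x, galois_apply_mem_Zbar σ x.2⟩ x).mpr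
      (h x (norm_coe_Zbar_le_one x))

instance inertia_normal : (inertia ℓ).Normal where
  conj_mem σ hσ τ := mem_inertia_iff.mpr fun x hx => by
    have h := mem_inertia_iff.mp hσ (τ⁻¹ x) ((norm_galois_apply _ _).trans_le hx)
    rw [← norm_galois_apply τ, map_sub] at h
    simpa using h

/-- The action of `G_{ℚ_ℓ}` on the ring of integers of `ℚ̄_ℓ`. -/
instance galoisActionZbar : MulSemiringAction (GQl ℓ) (Zbar ℓ) where
  smul σ x := ⟨σ x, galois_apply_mem_Zbar σ x.2⟩
  one_smul _ := rfl
  mul_smul _ _ _ := rfl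
  smul_zero σ := Subtype.ext (map_zero σ)
  smul_add σ _ _ := Subtype.ext (map_add σ _ _)
  smul_one σ := Subtype.ext (map_one σ)
  smul_mul σ _ _ := Subtype.ext (map_mul σ _ _)

theorem coe_galois_smul (σ : GQl ℓ) (x : Zbar ℓ) : ((σ • x : Zbar ℓ) : PadicAlgCl ℓ) = σ x := rfl

theorem galois_smul_maximalIdeal (σ : GQl ℓ) :
    σ • IsLocalRing.maximalIdeal (Zbar ℓ) = IsLocalRing.maximalIdeal (Zbar ℓ) := by
  ext x
  rw [Ideal.mem_pointwise_smul_iff_inv_smul_mem, mem_maximalIdeal_Zbar_iff,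
    mem_maximalIdeal_Zbar_iff, coe_galois_smul, norm_galois_apply]

/-- The automorphism of the residue field of `ℚ̄_ℓ` induced by `σ` is trivial on the residues coming
from `M`. The stabilizer of the maximal ideal in `Gal(ℚ̄_ℓ/M)` surjects onto such automorphisms,
which gives `τ`. -/
theorem exists_mem_fixingSubgroup_norm_sub_lt_one
    (M : IntermediateField ℚ_[ℓ] (PadicAlgCl ℓ)) [FiniteDimensional ℚ_[ℓ] M] (σ : GQl ℓ)
    (h : ∀ x ∈ M, ‖x‖ ≤ 1 → ‖σ x - x‖ < 1) :
    ∃ τ ∈ M.fixingSubgroup, ∀ x : PadicAlgCl ℓ, ‖x‖ ≤ 1 → ‖τ x - σ x‖ < 1 := by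
  let H := M.fixingSubgroup
  let A := FixedPoints.subalgebra ℤ (Zbar ℓ) H
  let Q := IsLocalRing.maximalIdeal (Zbar ℓ)
  let P := Q.under A
  have : CompactSpace H := isCompact_iff_compactSpace.mp
    (IntermediateField.fixingSubgroup_isClosed M).isCompact
  -- The discrete topology, not the valuation topology: continuity of the action then means open
  -- stabilizers.
  let : TopologicalSpace (Zbar ℓ) := ⊥
  have : DiscreteTopology (Zbar ℓ) := ⟨rfl⟩
  have : ContinuousSMul H (Zbar ℓ) := by
    rw [continuousSMul_iff_stabilizer_isOpen]
    intro x
    have hx : IsOpen (MulAction.stabilizer (GQl ℓ) (x : PadicAlgCl ℓ) : Set (GQl ℓ)) :=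
      stabilizer_isOpen_of_isIntegral _
    convert! hx.preimage (continuous_subtype_val (p := (· ∈ H))) using 1
    ext τ
    exact Subtype.ext_iff
  have : Algebra.IsInvariant A (Zbar ℓ) H := ⟨fun b hb => ⟨⟨b, hb⟩, rfl⟩⟩
  have : SMulCommClass H A (Zbar ℓ) := ⟨fun τ a b => by
    rw [Algebra.smul_def, Algebra.smul_def, smul_mul']
    exact congrArg (· * τ • b) (a.2 τ)⟩
  have hA (x : A) : ((x : Zbar ℓ) : PadicAlgCl ℓ) ∈ M := by
    rw [← InfiniteGalois.fixedField_fixingSubgroup M]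
    rintro ⟨τ, hτ⟩
    exact congrArg Subtype.val (x.2 ⟨τ, hτ⟩)
  let e : (Zbar ℓ ⧸ Q) ≃+* (Zbar ℓ ⧸ Q) :=
    Ideal.quotientEquiv Q Q (MulSemiringAction.toRingEquiv (GQl ℓ) (Zbar ℓ) σ)
      (galois_smul_maximalIdeal σ).symm
  let e' : (Zbar ℓ ⧸ Q) ≃ₐ[A ⧸ P] (Zbar ℓ ⧸ Q) := AlgEquiv.ofRingEquiv (f := e) (by
    intro a
    obtain ⟨a, rfl⟩ := Ideal.Quotient.mk_surjective a
    exact (residue_eq_iff _ _).mpr (h _ (hA a) (norm_coe_Zbar_le_one _)))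
  obtain ⟨τ, hτ⟩ := Ideal.Quotient.stabilizerHom_surjective_of_profinite (G := H) P Q e'
  refine ⟨τ.1.1, τ.1.2, fun x hx => ?_⟩
  let y : Zbar ℓ := ⟨x, mem_Zbar_iff.mpr hx⟩
  exact (residue_eq_iff (τ.1.1 • y) (σ • y)).mp
    (DFunLike.congr_fun hτ (Ideal.Quotient.mk Q y))

/-- Distinct characters of a monoid can be separated by a linear combination of values. -/
theorem exists_sum_mul_apply_eq_single {Γ O k : Type*} [Finite Γ] [DecidableEq Γ] [Monoid O]
    [Field k] (f : Γ → O →* k) (hf : Function.Injective f) (g₀ : Γ) :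
    ∃ c : O →₀ k, ∀ g, c.sum (fun u a => a * f g u) = (Pi.single g₀ 1 : Γ → k) g := by
  have : Fintype Γ := Fintype.ofFinite Γ
  let ev : O → Γ → k := fun u g => f g u
  -- A nonzero functional vanishing on all evaluation vectors would be a linear relation among
  -- distinct characters, against Dedekind's theorem.
  have hspan : Submodule.span k (Set.range ev) = ⊤ := by
    by_contra hne
    obtain ⟨φ, hφ, hle⟩ := Submodule.exists_le_ker_of_lt_top _ (lt_top_iff_ne_top.mpr hne)
    have hli := (linearIndependent_monoidHom O k).comp f hf
    rw [Fintype.linearIndependent_iff] at hli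
    refine hφ (LinearMap.pi_ext' fun g => LinearMap.ext_ring ?_)
    refine hli (fun g => φ (Pi.single g 1)) (funext fun u => ?_) g
    have h0 : φ (ev u) = 0 := hle (Submodule.subset_span ⟨u, rfl⟩)
    have h1 : ev u = ∑ g, f g u • Pi.single g (1 : k) := by
      rw [← Finset.univ_sum_single (ev u)]
      simp [ev, ← Pi.single_smul]
    rw [h1, map_sum] at h0
    simpa [mul_comm] using h0
  have hmem : (Pi.single g₀ 1 : Γ → k) ∈ Submodule.span k (Set.range ev) := by
    rw [hspan]; trivial
  obtain ⟨c, hc⟩ := Finsupp.mem_span_range_iff_exists_finsupp.mp hmem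
  refine ⟨c, fun g => ?_⟩
  rw [← hc]
  simp [Finsupp.sum, ev]

theorem norm_le_inv_of_norm_lt_one {x : ℚ_[ℓ]} (hx : ‖x‖ < 1) : ‖x‖ ≤ (ℓ : ℝ)⁻¹ := by
  have := (Padic.norm_le_pow_iff_norm_lt_pow_add_one x (-1)).mpr (by simpa using hx)
  simpa using this

/-- Inertia is a normal subgroup, so its fixed field is normal and contains the conjugates of each
of its elements. -/
theorem normalClosure_adjoin_le_fixedField_inertia {x : PadicAlgCl ℓ}
    (hx : ∀ σ ∈ inertia ℓ, σ x = x) :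
    IntermediateField.normalClosure ℚ_[ℓ] (IntermediateField.adjoin ℚ_[ℓ] {x}) (PadicAlgCl ℓ) ≤
      IntermediateField.fixedField (inertia ℓ) := by
  rw [IntermediateField.normalClosure_le_iff_of_normal, IntermediateField.adjoin_simple_le_iff]
  exact fun σ => hx σ σ.2

/-- Some `τ` fixing `M` has the same residual action as `σ`. Then `τ⁻¹ * σ` lies in inertia, which
fixes `M`, so `σ` fixes `M` too. -/
theorem eq_one_of_residually_trivial {M : IntermediateField ℚ_[ℓ] (PadicAlgCl ℓ)}
    [FiniteDimensional ℚ_[ℓ] M] (hM : M ≤ IntermediateField.fixedField (inertia ℓ)) {σ : GQl ℓ}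
    (h : ∀ x ∈ M, ‖x‖ ≤ 1 → ‖σ x - x‖ < 1) : ∀ x ∈ M, σ x = x := by
  obtain ⟨τ, hτM, hτ⟩ := exists_mem_fixingSubgroup_norm_sub_lt_one M σ h
  intro x hx
  have hmem : τ⁻¹ * σ ∈ inertia ℓ := mem_inertia_iff.mpr fun y hy => by
    have h1 := hτ y hy
    rw [← norm_galois_apply τ⁻¹, map_sub, norm_sub_rev] at h1
    simpa using h1
  have h1 : τ⁻¹ (σ x) = x := hM hx ⟨_, hmem⟩
  have h2 : τ x = x := hτM ⟨x, hx⟩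
  have h3 := congrArg τ h1
  rw [h2] at h3
  simpa using h3

/-- The fixed field of inertia has the same value group as `ℚ_ℓ`. -/
theorem norm_le_inv_of_fixed_by_inertia {y : PadicAlgCl ℓ} (hy : ∀ σ ∈ inertia ℓ, σ y = y)
    (hy1 : ‖y‖ < 1) : ‖y‖ ≤ (ℓ : ℝ)⁻¹ := by
  classical
  let M := IntermediateField.normalClosure ℚ_[ℓ] (IntermediateField.adjoin ℚ_[ℓ] {y})
    (PadicAlgCl ℓ)
  have : FiniteDimensional ℚ_[ℓ] (IntermediateField.adjoin ℚ_[ℓ] {y}) :=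
    IntermediateField.adjoin.finiteDimensional (Algebra.IsIntegral.isIntegral y)
  have : FiniteDimensional ℚ_[ℓ] M := inferInstance
  have : IsGalois ℚ_[ℓ] M := {}
  have hM : M ≤ IntermediateField.fixedField (inertia ℓ) :=
    normalClosure_adjoin_le_fixedField_inertia hy
  have hyM : y ∈ M := IntermediateField.le_normalClosure _
    (IntermediateField.mem_adjoin_simple_self ℚ_[ℓ] y)
  let lift : Gal(M/ℚ_[ℓ]) → GQl ℓ := fun g => g.liftNormal (PadicAlgCl ℓ)
  have hlift (g : Gal(M/ℚ_[ℓ])) (x : M) : lift g x = g x := g.liftNormal_commutes _ x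
  let O : Subring M := (Zbar ℓ).toSubring.comap (algebraMap M (PadicAlgCl ℓ))
  let toZ : O →* Zbar ℓ :=
    { toFun := fun u => ⟨(u : M), u.2⟩, map_one' := rfl, map_mul' := fun _ _ => rfl }
  let f : Gal(M/ℚ_[ℓ]) → O →* IsLocalRing.ResidueField (Zbar ℓ) := fun g =>
    (IsLocalRing.residue (Zbar ℓ)).toMonoidHom.comp
      ((MulSemiringAction.toRingHom (GQl ℓ) (Zbar ℓ) (lift g)).toMonoidHom.comp toZ)
  have hfapp (g : Gal(M/ℚ_[ℓ])) (u : O) :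
      f g u = IsLocalRing.residue (Zbar ℓ) (lift g • toZ u) := rfl
  have hf : Function.Injective f := by
    intro g g' hgg'
    have h1 := eq_one_of_residually_trivial hM (σ := (lift g')⁻¹ * lift g) (by
      intro x hx hx1
      let u : O := ⟨⟨x, hx⟩, mem_Zbar_iff.mpr hx1⟩
      have h2 : f g u = f g' u := by rw [hgg']
      rw [hfapp, hfapp, residue_eq_iff] at h2
      have h3 : ‖lift g x - lift g' x‖ < 1 := h2
      rw [← norm_galois_apply (lift g')⁻¹, map_sub] at h3
      simpa using h3)
    ext x
    have h2 := congrArg (lift g') (h1 x x.2)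
    rw [← hlift, ← hlift, ← h2]
    simp
  obtain ⟨c, hc⟩ := exists_sum_mul_apply_eq_single f hf 1
  choose C hC using fun u => IsLocalRing.residue_surjective (c u)
  -- Lifting the separating combination from the residue field makes `w g` close to `1` for `g = 1`
  -- and to `0` otherwise.
  let w : Gal(M/ℚ_[ℓ]) → PadicAlgCl ℓ := fun g => ∑ u ∈ c.support, C u * lift g (u : M)
  have hw (g : Gal(M/ℚ_[ℓ])) : ‖w g - (Pi.single 1 1 : Gal(M/ℚ_[ℓ]) → PadicAlgCl ℓ) g‖ < 1 := by
    have h1 : IsLocalRing.residue (Zbar ℓ) (∑ u ∈ c.support, C u * (lift g • toZ u)) =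
        IsLocalRing.residue (Zbar ℓ) ((Pi.single 1 1 : Gal(M/ℚ_[ℓ]) → Zbar ℓ) g) := by
      rw [map_sum]
      refine Eq.trans (Eq.trans ?_ (hc g)) ?_
      · exact Finset.sum_congr rfl fun u _ => by
          rw [map_mul, hC, ← hfapp]
      · by_cases hg : g = 1
        · subst hg; simp
        · simp [hg]
    have h2 := (residue_eq_iff _ _).mp h1
    convert h2 using 3
    · simp [w, coe_galois_smul]; rfl
    · by_cases hg : g = 1
      · subst hg; simp
      · simp [hg]
  let Y : M := ⟨y, hyM⟩
  -- The sum is the trace of `u * y`. It lies in `ℚ_ℓ` and has norm below `1`, so discreteness of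
  -- the valuation of `ℚ_ℓ` improves the bound to `1/ℓ`.
  have htr (u : O) : ‖∑ g, lift g (u : M) * lift g y‖ ≤ (ℓ : ℝ)⁻¹ := by
    have h1 : ∑ g, lift g (u : M) * lift g y =
        algebraMap ℚ_[ℓ] (PadicAlgCl ℓ) (Algebra.trace ℚ_[ℓ] M (u * Y)) := by
      rw [IsScalarTower.algebraMap_apply ℚ_[ℓ] M, trace_eq_sum_automorphisms, map_sum]
      refine Finset.sum_congr rfl fun g _ => ?_
      rw [← map_mul]
      exact hlift g (u * Y)
    have h2 : ‖∑ g, lift g (u : M) * lift g y‖ ≤ ‖y‖ := by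
      refine IsUltrametricDist.norm_sum_le_of_forall_le_of_nonneg (norm_nonneg y) fun g _ => ?_
      rw [norm_mul, norm_galois_apply, norm_galois_apply]
      exact mul_le_of_le_one_left (norm_nonneg y) (mem_Zbar_iff.mp u.2)
    rw [h1, PadicAlgCl.norm_extends] at h2 ⊢
    exact norm_le_inv_of_norm_lt_one (h2.trans_lt hy1)
  have hsum : ‖∑ g, w g * lift g y‖ ≤ (ℓ : ℝ)⁻¹ := by
    have h1 : ∑ g, w g * lift g y = ∑ u ∈ c.support, C u * ∑ g, lift g (u : M) * lift g y := by
      simp only [w, Finset.sum_mul, Finset.mul_sum]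
      rw [Finset.sum_comm]
      simp only [mul_assoc]
    rw [h1]
    refine IsUltrametricDist.norm_sum_le_of_forall_le_of_nonneg (by positivity) fun u _ => ?_
    rw [norm_mul]
    exact (mul_le_of_le_one_left (norm_nonneg _) (norm_coe_Zbar_le_one _)).trans (htr u)
  by_contra hlt
  push Not at hlt
  have hy0 : 0 < ‖y‖ := lt_trans (by have := (Fact.out : ℓ.Prime).pos; positivity) hlt
  -- The first sum is a combination of traces, of norm at most `1/ℓ`; the second is smaller than `y`
  -- because `w` is close to the indicator of `1`. If `‖y‖ > 1/ℓ`, both are smaller than `y`.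
  have hsplit : y = ∑ g, w g * lift g y -
      ∑ g, (w g - (Pi.single 1 1 : Gal(M/ℚ_[ℓ]) → PadicAlgCl ℓ) g) * lift g y := by
    rw [← Finset.sum_sub_distrib]
    simp only [← sub_mul, sub_sub_cancel]
    simp only [Pi.single_apply, ite_mul, one_mul, zero_mul, Finset.sum_ite_eq',
      Finset.mem_univ, if_true]
    exact (hlift 1 Y).symm
  have hsmall : ‖∑ g, (w g - (Pi.single 1 1 : Gal(M/ℚ_[ℓ]) → PadicAlgCl ℓ) g) * lift g y‖
      < ‖y‖ := by
    obtain ⟨g, -, hg⟩ := IsUltrametricDist.exists_norm_finsetSum_le_of_nonempty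
      (t := (Finset.univ : Finset Gal(M/ℚ_[ℓ]))) ⟨1, Finset.mem_univ _⟩
      (fun g => (w g - (Pi.single 1 1 : Gal(M/ℚ_[ℓ]) → PadicAlgCl ℓ) g) * lift g y)
    refine hg.trans_lt ?_
    rw [norm_mul, norm_galois_apply]
    exact mul_lt_of_lt_one_left hy0 (hw g)
  rw [sub_eq_add_neg] at hsplit
  have h1 := (congrArg norm hsplit).trans_le (IsUltrametricDist.norm_add_le_max _ _)
  rw [norm_neg] at h1
  exact absurd h1 (not_le.mpr (max_lt (hsum.trans_lt hlt) hsmall))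

end RegularGalois

end

/-! ### Periodic base `ℓ` digits modulo `ℓ^R - 1`. -/

noncomputable section

namespace RegularGalois

section Digits

/-- The number with digits `A 0, …, A (R - 1)` in base `ℓ`. -/
def digitSum (ℓ R : ℕ) (A : ℕ → ℕ) : ℕ := ∑ t ∈ Finset.range R, A t * ℓ ^ t

variable {ℓ R : ℕ}

/-- Since `ℓ^R ≡ 1`, multiplication by `ℓ` rotates the digits. The shift by `R - 1` is the shift by
`-1`, by periodicity. -/
theorem mul_digitSum_modEq (hℓ : 0 < ℓ) (hR : 0 < R) {A : ℕ → ℕ} (hA : ∀ t, A (t + R) = A t) :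
    ℓ * digitSum ℓ R A ≡ digitSum ℓ R (fun t => A (t + (R - 1))) [MOD ℓ ^ R - 1] := by
  obtain ⟨R, rfl⟩ : ∃ S, R = S + 1 := ⟨R - 1, by omega⟩
  have h1 : digitSum ℓ (R + 1) (fun t => A (t + (R + 1 - 1))) =
      ∑ t ∈ Finset.range R, A t * ℓ ^ (t + 1) + A R := by
    simp only [digitSum]
    rw [Finset.sum_range_succ']
    congr 1
    · refine Finset.sum_congr rfl fun t _ => ?_
      rw [← hA t]
      congr 2
      omega
    · simp
  have h2 : ℓ * digitSum ℓ (R + 1) A =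
      ∑ t ∈ Finset.range R, A t * ℓ ^ (t + 1) + A R * ℓ ^ (R + 1) := by
    simp only [digitSum]
    rw [Finset.sum_range_succ, mul_add, Finset.mul_sum]
    congr 1
    · exact Finset.sum_congr rfl fun t _ => by ring
    · ring
  have h3 : ℓ ^ (R + 1) ≡ 1 [MOD ℓ ^ (R + 1) - 1] :=
    ((Nat.modEq_iff_dvd' (Nat.one_le_pow _ _ hℓ)).mpr dvd_rfl).symm
  rw [h1, h2]
  simpa using (h3.mul_left (A R)).add_left (∑ t ∈ Finset.range R, A t * ℓ ^ (t + 1))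

theorem pow_mul_digitSum_modEq (hℓ : 0 < ℓ) (hR : 0 < R) {A : ℕ → ℕ}
    (hA : ∀ t, A (t + R) = A t) (c : ℕ) :
    ℓ ^ c * digitSum ℓ R A ≡ digitSum ℓ R (fun t => A (t + (R - 1) * c)) [MOD ℓ ^ R - 1] := by
  induction c with
  | zero => simp [Nat.ModEq.refl]
  | succ c ih =>
    have h := mul_digitSum_modEq hℓ hR (A := fun t => A (t + (R - 1) * c)) fun t => by
      rw [← hA (t + (R - 1) * c)]
      congr 1
      ring
    rw [pow_succ', mul_assoc]
    refine (ih.mul_left ℓ).trans ?_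
    convert! h using 3
    ring_nf

/-- With all digits below `ℓ - 1`, the sum is a reduced residue: in particular it cannot be `ℓ^R -
1`, which is congruent to `0`. -/
theorem digitSum_lt (hR : 0 < R) {A : ℕ → ℕ} (hA : ∀ t, A t + 1 < ℓ) :
    digitSum ℓ R A < ℓ ^ R - 1 := by
  have hℓ : 1 < ℓ := (Nat.le_add_left 1 _).trans_lt (hA 0)
  have h1 : (∑ t ∈ Finset.range R, ℓ ^ t) * (ℓ - 1) = ℓ ^ R - 1 := by
    have := geom_sum_mul_add (ℓ - 1) R
    rw [Nat.sub_add_cancel hℓ.le] at this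
    omega
  rw [← h1, Finset.sum_mul]
  refine Finset.sum_lt_sum_of_nonempty (Finset.nonempty_range_iff.mpr hR.ne') fun t _ => ?_
  rw [mul_comm]
  have := hA t
  exact Nat.mul_lt_mul_of_pos_left (by omega) (by positivity)

theorem digitSum_modEq_zero (hR : 0 < R) (A : ℕ → ℕ) : digitSum ℓ R A ≡ A 0 [MOD ℓ] := by
  obtain ⟨R, rfl⟩ : ∃ S, R = S + 1 := ⟨R - 1, by omega⟩
  simp only [digitSum]
  rw [Finset.sum_range_succ', pow_zero, mul_one]
  refine (Nat.ModEq.add_right _ ((Nat.modEq_zero_iff_dvd).mpr ?_)).trans (by rw [zero_add])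
  exact Finset.dvd_sum fun t _ => Dvd.dvd.mul_left (dvd_pow_self _ t.succ_ne_zero) _

theorem apply_zero_eq_of_digitSum_modEq (hR : 0 < R) {A B : ℕ → ℕ} (hA : ∀ t, A t + 1 < ℓ)
    (hB : ∀ t, B t + 1 < ℓ) (h : digitSum ℓ R A ≡ digitSum ℓ R B [MOD ℓ ^ R - 1]) :
    A 0 = B 0 := by
  have h1 := h.eq_of_lt_of_lt (digitSum_lt hR hA) (digitSum_lt hR hB)
  have h2 := (digitSum_modEq_zero (ℓ := ℓ) hR A).symm
  rw [h1] at h2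
  replace h2 := h2.trans (digitSum_modEq_zero hR B)
  exact h2.eq_of_lt_of_lt (by have := hA 0; omega) (by have := hB 0; omega)

theorem digitSum_mul_of_periodic (r s : ℕ) {A : ℕ → ℕ} (hA : ∀ t, A (t + r) = A t) :
    digitSum ℓ (r * s) A = (∑ q ∈ Finset.range s, (ℓ ^ r) ^ q) * digitSum ℓ r A := by
  induction s with
  | zero => simp [digitSum]
  | succ s ih =>
    rw [Finset.sum_range_succ, add_mul, ← ih, mul_add, mul_one]
    simp only [digitSum]
    rw [Finset.sum_range_add, Finset.mul_sum]
    congr 1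
    refine Finset.sum_congr rfl fun t _ => ?_
    have h1 : A (r * s + t) = A t := by
      rw [add_comm, mul_comm]
      exact Function.Periodic.nat_mul (f := A) hA s t
    rw [h1]
    ring

end Digits

/-! ### Surjectivity and comparison of fundamental characters. -/

variable {ℓ : ℕ} [Fact ℓ.Prime]

theorem prime_residue_eq_zero : (ℓ : IsLocalRing.ResidueField (Zbar ℓ)) = 0 := by
  rw [← map_natCast (IsLocalRing.residue (Zbar ℓ)), IsLocalRing.residue_eq_zero_iff,
    mem_maximalIdeal_Zbar_iff]
  have h : ‖(ℓ : PadicAlgCl ℓ)‖ < 1 := by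
    rw [norm_natCast_prime]
    exact inv_lt_one_of_one_lt₀ (by exact_mod_cast (Fact.out : ℓ.Prime).one_lt)
  exact h

/-- Roots of unity of order prime to `ℓ` inject into the residue field. -/
theorem eq_one_of_pow_eq_one_of_residue_eq_one (r : ℕ+) {x : Zbar ℓ}
    (hx : x ^ (ℓ ^ (r : ℕ) - 1) = 1) (hres : IsLocalRing.residue (Zbar ℓ) x = 1) : x = 1 := by
  by_contra hne
  -- If `x` has residue `1`, this sum has residue `ℓ^r - 1 = -1`, which is not zero.
  have h1 : (∑ i ∈ Finset.range (ℓ ^ (r : ℕ) - 1), x ^ i) = 0 := by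
    have := geom_sum_mul x (ℓ ^ (r : ℕ) - 1)
    rw [hx, sub_self] at this
    exact (mul_eq_zero.mp this).resolve_right (sub_ne_zero.mpr hne)
  have h2 := congrArg (IsLocalRing.residue (Zbar ℓ)) h1
  simp only [map_sum, map_pow, hres, one_pow, map_zero, Finset.sum_const, Finset.card_range,
    nsmul_eq_mul, mul_one] at h2
  rw [Nat.cast_sub (Nat.one_le_pow _ _ (Fact.out : ℓ.Prime).pos), Nat.cast_pow,
    prime_residue_eq_zero, zero_pow r.ne_zero] at h2
  simp at h2

theorem coe_fundamentalCharacter (r : ℕ+) (ι : IsLocalRing.ResidueField (Zbar ℓ) →+* Fbar ℓ)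
    (σ : inertia ℓ) : (fundamentalCharacter ℓ r ι σ : Fbar ℓ) =
      ι (IsLocalRing.residue (Zbar ℓ) (rootQuotient ℓ r σ)) := rfl

theorem rootQuotient_pow (r : ℕ+) (σ : GQl ℓ) :
    rootQuotient ℓ r σ ^ (ℓ ^ (r : ℕ) - 1) = 1 := Subtype.ext (apply_root_div_pow ℓ r σ)

theorem fundamentalCharacter_pow (r : ℕ+)
    (ι : IsLocalRing.ResidueField (Zbar ℓ) →+* Fbar ℓ) (σ : inertia ℓ) :
    fundamentalCharacter ℓ r ι σ ^ (ℓ ^ (r : ℕ) - 1) = 1 := by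
  ext
  rw [Units.val_pow_eq_pow_val, coe_fundamentalCharacter, ← map_pow, ← map_pow, rootQuotient_pow]
  simp

theorem norm_rootOfEll_pow (r : ℕ+) :
    ‖rootOfEll ℓ r‖ ^ (ℓ ^ (r : ℕ) - 1) = (ℓ : ℝ)⁻¹ := by
  rw [← norm_pow, rootOfEll_pow, norm_natCast_prime]

theorem norm_rootOfEll_lt_one (r : ℕ+) : ‖rootOfEll ℓ r‖ < 1 := by
  by_contra h
  have h1 := one_le_pow₀ (n := ℓ ^ (r : ℕ) - 1) (not_lt.mp h)
  rw [norm_rootOfEll_pow] at h1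
  exact absurd h1 (not_le.mpr
    (inv_lt_one_of_one_lt₀ (by exact_mod_cast (Fact.out : ℓ.Prime).one_lt)))

/-- A fundamental character of niveau `r` is surjective onto the `(ℓ^r - 1)`-th roots of unity;
we choose an element of inertia which is mapped to a generator. -/
theorem exists_orderOf_fundamentalCharacter (r : ℕ+)
    (ι : IsLocalRing.ResidueField (Zbar ℓ) →+* Fbar ℓ) :
    ∃ σ : inertia ℓ, orderOf (fundamentalCharacter ℓ r ι σ) = ℓ ^ (r : ℕ) - 1 ∧
      ∀ τ : inertia ℓ, ∃ i : ℕ,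
        fundamentalCharacter ℓ r ι τ = fundamentalCharacter ℓ r ι σ ^ i := by
  have hN := pow_sub_one_ne_zero ℓ r
  have : NeZero (ℓ ^ (r : ℕ) - 1) := ⟨hN⟩
  let ψ := fundamentalCharacter ℓ r ι
  have hle : ψ.range ≤ rootsOfUnity (ℓ ^ (r : ℕ) - 1) (Fbar ℓ) := by
    rintro _ ⟨σ, rfl⟩
    exact fundamentalCharacter_pow r ι σ
  have : Finite ψ.range := Set.Finite.subset (s := rootsOfUnity (ℓ ^ (r : ℕ) - 1) (Fbar ℓ))
    (inferInstanceAs (Finite (rootsOfUnity (ℓ ^ (r : ℕ) - 1) (Fbar ℓ)))) hle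
  obtain ⟨⟨_, σ, rfl⟩, hσ⟩ := IsCyclic.exists_generator (α := ψ.range)
  have hgen (τ : inertia ℓ) : ∃ i : ℕ, ψ τ = ψ σ ^ i := by
    obtain ⟨i, hi⟩ := (mem_powers_iff_mem_zpowers).mpr (hσ ⟨ψ τ, τ, rfl⟩)
    exact ⟨i, (congrArg Subtype.val hi).symm⟩
  refine ⟨σ, ?_, hgen⟩
  have hdvd : orderOf (ψ σ) ∣ ℓ ^ (r : ℕ) - 1 :=
    orderOf_dvd_of_pow_eq_one (fundamentalCharacter_pow r ι σ)
  refine le_antisymm (Nat.le_of_dvd (Nat.pos_of_ne_zero hN) hdvd) ?_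
  set d := orderOf (ψ σ) with hd
  have hd0 : d ≠ 0 := fun h0 => hN (Nat.eq_zero_of_zero_dvd (h0 ▸ hdvd))
  -- With `ϖ = rootOfEll ℓ r`, the quotient `(τ ϖ / ϖ) ^ d` is a root of unity of order prime to `ℓ`
  -- with residue `1`. Hence `ϖ ^ d` is fixed by inertia and has norm at most `1/ℓ = ‖ϖ‖ ^ (ℓ^r -
  -- 1)`, which forces `d ≥ ℓ^r - 1`.
  have hfix : ∀ τ ∈ inertia ℓ, τ (rootOfEll ℓ r ^ d) = rootOfEll ℓ r ^ d := by
    intro τ hτ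
    obtain ⟨i, hi⟩ := hgen ⟨τ, hτ⟩
    have h1 : ψ ⟨τ, hτ⟩ ^ d = 1 := by
      rw [hi, ← pow_mul, mul_comm, pow_mul, pow_orderOf_eq_one, one_pow]
    have h2 : ι (IsLocalRing.residue (Zbar ℓ) (rootQuotient ℓ r τ ^ d)) = 1 := by
      rw [map_pow, map_pow]
      exact congrArg Units.val h1
    have h3 : rootQuotient ℓ r τ ^ d = 1 :=
      eq_one_of_pow_eq_one_of_residue_eq_one r
        (by rw [← pow_mul, mul_comm, pow_mul, rootQuotient_pow, one_pow])
        (ι.injective (h2.trans (map_one ι).symm))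
    have h4 : (τ (rootOfEll ℓ r) / rootOfEll ℓ r) ^ d = 1 := congrArg Subtype.val h3
    rw [div_pow, div_eq_one_iff_eq (pow_ne_zero _ (rootOfEll_ne_zero ℓ r))] at h4
    rw [map_pow, h4]
  have h1 := norm_le_inv_of_fixed_by_inertia hfix
    (by rw [norm_pow]; exact pow_lt_one₀ (norm_nonneg _) (norm_rootOfEll_lt_one r) hd0)
  rw [norm_pow, ← norm_rootOfEll_pow r] at h1
  exact (pow_le_pow_iff_right_of_lt_one₀ (norm_pos_iff.mpr (rootOfEll_ne_zero ℓ r))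
    (norm_rootOfEll_lt_one r)).mp h1

/-- Two embeddings of the residue field into `𝔽̄_ℓ` differ on each element by a power of
Frobenius. -/
theorem exists_pow_eq_of_ringHom {k : Type*} [Field k] (ι ι' : k →+* Fbar ℓ) (u : k) :
    ∃ c : ℕ, ι' u = ι u ^ ℓ ^ c := by
  have : CharP k ℓ := (RingHom.charP_iff ι ι.injective ℓ).mpr inferInstance
  let : Algebra (ZMod ℓ) k := ZMod.algebra k ℓ
  let f : k →ₐ[ZMod ℓ] Fbar ℓ := AlgHom.mk ι fun x =>
    DFunLike.congr_fun (Subsingleton.elim (ι.comp (algebraMap (ZMod ℓ) k)) (algebraMap _ _)) x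
  let f' : k →ₐ[ZMod ℓ] Fbar ℓ := AlgHom.mk ι' fun x =>
    DFunLike.congr_fun (Subsingleton.elim (ι'.comp (algebraMap (ZMod ℓ) k)) (algebraMap _ _)) x
  have hconj : IsConjRoot (ZMod ℓ) (f' u) (f u) := by
    rw [isConjRoot_def, minpoly.algHom_eq f f.injective, minpoly.algHom_eq f' f'.injective]
  obtain ⟨τ, hτ⟩ := isConjRoot_iff_exists_algEquiv.mp hconj
  let E := IntermediateField.adjoin (ZMod ℓ) {f u}
  have : FiniteDimensional (ZMod ℓ) E :=
    IntermediateField.adjoin.finiteDimensional (Algebra.IsIntegral.isIntegral _)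
  have : Finite E := Module.finite_of_finite (ZMod ℓ)
  obtain ⟨c, hc⟩ := (FiniteField.bijective_frobeniusAlgEquivOfAlgebraic_pow (ZMod ℓ) E).2
    (τ.restrictNormal E)
  refine ⟨c, ?_⟩
  let x : E := ⟨f u, IntermediateField.mem_adjoin_simple_self _ _⟩
  have h1 : ((τ.restrictNormal E x : E) : Fbar ℓ) = τ (f u) := τ.restrictNormal_commutes E x
  have h2 : τ.restrictNormal E x = x ^ ℓ ^ (c : ℕ) := by
    rw [← hc, AlgEquiv.coe_pow, FiniteField.coe_frobeniusAlgEquivOfAlgebraic_iterate]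
    simp
  rw [h2] at h1
  exact (h1.trans hτ).symm

/-- The `Q`-th power of the chosen root for `R` differs from the root for `r` by a root of unity
`ζ`. This is a unit, so `σ ζ / ζ` has residue `1`. -/
theorem residue_rootQuotient_eq_pow {r R : ℕ+} {Q : ℕ}
    (hQ : (ℓ ^ (r : ℕ) - 1) * Q = ℓ ^ (R : ℕ) - 1) {σ : GQl ℓ} (hσ : σ ∈ inertia ℓ) :
    IsLocalRing.residue (Zbar ℓ) (rootQuotient ℓ r σ) =
      IsLocalRing.residue (Zbar ℓ) (rootQuotient ℓ R σ) ^ Q := by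
  have hr := rootOfEll_ne_zero ℓ r
  have hR := rootOfEll_ne_zero ℓ R
  set ζ := rootOfEll ℓ R ^ Q / rootOfEll ℓ r with hζ
  have hζN : ζ ^ (ℓ ^ (r : ℕ) - 1) = 1 := by
    rw [hζ, div_pow, ← pow_mul, mul_comm, hQ, rootOfEll_pow, rootOfEll_pow, div_self]
    exact_mod_cast (Fact.out : ℓ.Prime).ne_zero
  have hζ1 : ‖ζ‖ = 1 := by
    have := congrArg norm hζN
    rw [norm_pow, norm_one] at this
    exact (pow_eq_one_iff_of_nonneg (norm_nonneg _) (pow_sub_one_ne_zero ℓ r)).mp this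
  have hζ0 : ζ ≠ 0 := norm_ne_zero_iff.mp (hζ1.trans_ne one_ne_zero)
  have h1 := mem_inertia_iff.mp hσ ζ hζ1.le
  rw [← map_pow, residue_eq_iff]
  have h2 : (σ (rootOfEll ℓ R) / rootOfEll ℓ R) ^ Q =
      (σ (rootOfEll ℓ r) / rootOfEll ℓ r) * (σ ζ / ζ) := by
    rw [hζ, map_div₀, map_pow]
    have : σ (rootOfEll ℓ r) ≠ 0 := by simpa using hr
    rw [div_pow]
    field_simp
  have h3 : ‖σ (rootOfEll ℓ r) / rootOfEll ℓ r - (σ (rootOfEll ℓ R) / rootOfEll ℓ R) ^ Q‖ < 1 := by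
    rw [h2, ← mul_one_sub, norm_mul, norm_div, norm_galois_apply, div_self (norm_ne_zero_iff.mpr hr),
      one_mul, one_sub_div hζ0, norm_div, hζ1, div_one, norm_sub_rev]
    exact h1
  exact h3

theorem exists_fundamentalCharacter_eq_pow {r R : ℕ+} {Q : ℕ}
    (hQ : (ℓ ^ (r : ℕ) - 1) * Q = ℓ ^ (R : ℕ) - 1)
    (ι ι' : IsLocalRing.ResidueField (Zbar ℓ) →+* Fbar ℓ) (σ : inertia ℓ) :
    ∃ c : ℕ, fundamentalCharacter ℓ r ι' σ = fundamentalCharacter ℓ R ι σ ^ (ℓ ^ c * Q) := by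
  obtain ⟨c, hc⟩ := exists_pow_eq_of_ringHom ι ι'
    (IsLocalRing.residue (Zbar ℓ) (rootQuotient ℓ R σ))
  refine ⟨c, Units.ext ?_⟩
  rw [Units.val_pow_eq_pow_val, coe_fundamentalCharacter, coe_fundamentalCharacter,
    residue_rootQuotient_eq_pow hQ σ.2, map_pow, hc, pow_mul]

end RegularGalois

end

/-! ### Distinct weights give distinct eigenvalues. -/

noncomputable section

namespace RegularGalois

theorem digitSum_fin {ℓ : ℕ} (r : ℕ+) (a : Fin r → ℕ) (e : ℕ) :
    digitSum ℓ r (fun t => e * a (Fin.ofNat r t)) = e * ∑ t : Fin r, a t * ℓ ^ (t : ℕ) := by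
  rw [digitSum, Finset.sum_range, Finset.mul_sum]
  exact Finset.sum_congr rfl fun t _ => by rw [Fin.ofNat_val_eq_self, mul_assoc]

variable {ℓ : ℕ} [Fact ℓ.Prime]

/-- If the digits `a i j` are distinct and `e * a i j < ℓ - 1`, then the `e`-th powers of the
characters `ψ_{r i}^(b_i ℓ^j)` are pairwise distinct at an element of inertia at which a
fundamental character of a niveau divisible by every `r i` takes a generator as its value. -/
theorem injective_fundamentalCharacter_pow
    (ι : ℕ+ → (IsLocalRing.ResidueField (Zbar ℓ) →+* Fbar ℓ)) {s : ℕ} (r : Fin s → ℕ+)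
    (a : (i : Fin s) → Fin (r i) → ℕ) {e : ℕ} (he : 0 < e) (ha : ∀ i j, e * a i j + 1 < ℓ)
    (hinj : Function.Injective (fun p : (i : Fin s) × Fin (r i) => a p.1 p.2))
    (R : ℕ+) (hR : ∀ i, r i ∣ R) (σ : inertia ℓ)
    (hσ : orderOf (fundamentalCharacter ℓ R (ι R) σ) = ℓ ^ (R : ℕ) - 1) :
    Function.Injective (fun p : (i : Fin s) × Fin (r i) =>
      (fundamentalCharacter ℓ (r p.1) (ι (r p.1)) σ ^
        ((∑ t : Fin (r p.1), a p.1 t * ℓ ^ (t : ℕ)) * ℓ ^ (p.2 : ℕ))) ^ e) := by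
  have hℓ : 0 < ℓ := (Fact.out : ℓ.Prime).pos
  choose q hq using hR
  let Q (i : Fin s) : ℕ := ∑ x ∈ Finset.range (q i), (ℓ ^ (r i : ℕ)) ^ x
  have hQ (i : Fin s) : (ℓ ^ (r i : ℕ) - 1) * Q i = ℓ ^ (R : ℕ) - 1 := by
    have h1 := geom_sum_mul_add (ℓ ^ (r i : ℕ) - 1) (q i)
    rw [Nat.sub_add_cancel (Nat.one_le_pow _ _ hℓ)] at h1
    have h2 : (R : ℕ) = r i * q i := by rw [hq i, PNat.mul_coe]
    rw [h2, pow_mul, ← h1, Nat.add_sub_cancel, mul_comm]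
  choose c hc using fun i => exists_fundamentalCharacter_eq_pow (hQ i) (ι R) (ι (r i)) σ
  let A (i : Fin s) (t : ℕ) : ℕ := e * a i (Fin.ofNat (r i) t)
  have hAr (i : Fin s) (t : ℕ) : A i (t + r i) = A i t := by
    simp only [A]
    congr 2
    exact Fin.ext (Nat.add_mod_right t (r i))
  have hAR (i : Fin s) (t : ℕ) : A i (t + R) = A i t := by
    rw [hq i, PNat.mul_coe, mul_comm]
    exact Function.Periodic.nat_mul (f := A i) (hAr i) (q i) t
  have hdig (i : Fin s) :
      digitSum ℓ R (A i) = Q i * (e * ∑ t : Fin (r i), a i t * ℓ ^ (t : ℕ)) := by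
    rw [← digitSum_fin, ← digitSum_mul_of_periodic (r i) (q i) (hAr i), hq i, PNat.mul_coe]
  -- Every eigenvalue becomes a power of the single generator `ψ_R(σ)`: repeating the digit block `q
  -- i` times passes from niveau `r i` to `R`, and the Frobenius ambiguity `c i` only adds to the
  -- rotation.
  have hchar (p : (i : Fin s) × Fin (r i)) :
      (fundamentalCharacter ℓ (r p.1) (ι (r p.1)) σ ^
        ((∑ t : Fin (r p.1), a p.1 t * ℓ ^ (t : ℕ)) * ℓ ^ (p.2 : ℕ))) ^ e =
      fundamentalCharacter ℓ R (ι R) σ ^ (ℓ ^ (c p.1 + p.2) * digitSum ℓ R (A p.1)) := by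
    rw [hc, ← pow_mul, ← pow_mul, hdig]
    congr 1
    ring
  rintro ⟨i, j⟩ ⟨i', j'⟩ hpp
  replace hpp := ((hchar ⟨i, j⟩).symm.trans hpp).trans (hchar ⟨i', j'⟩)
  rw [pow_eq_pow_iff_modEq, hσ] at hpp
  have h1 := ((pow_mul_digitSum_modEq hℓ R.pos (hAR i) (c i + j)).symm.trans hpp).trans
    (pow_mul_digitSum_modEq hℓ R.pos (hAR i') (c i' + j'))
  have h2 := apply_zero_eq_of_digitSum_modEq R.pos (fun t => ha i _) (fun t => ha i' _) h1
  have h3 := @hinj ⟨i, _⟩ ⟨i', _⟩ (Nat.eq_of_mul_eq_mul_left he h2)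
  obtain ⟨rfl, h4⟩ := Sigma.mk.inj_iff.mp h3
  have h5 := congrArg Fin.val (eq_of_heq h4)
  -- Equal weights occupy equal positions, so the two rotations agree modulo `r i`. The factor `R -
  -- 1` is prime to `R`, hence to `r i`, and cancels.
  have h6 : ((R : ℕ) - 1) * (c i + j) ≡ ((R : ℕ) - 1) * (c i + j') [MOD r i] := by
    simpa [Nat.ModEq] using h5
  have h7 : ((R : ℕ) - 1).Coprime (r i) := by
    have h8 : ((R : ℕ) - 1).Coprime R := by
      conv_rhs => rw [← Nat.sub_add_cancel R.pos]
      simp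
    exact h8.coprime_dvd_right (by rw [hq i, PNat.mul_coe]; exact dvd_mul_right _ _)
  have h9 : (j : ℕ) ≡ j' [MOD r i] :=
    Nat.ModEq.add_left_cancel' (c i) (h6.cancel_left_of_coprime h7.symm)
  exact congrArg (Sigma.mk i) (Fin.ext (h9.eq_of_lt_of_lt j.2 j'.2))

end RegularGalois

end

/-! ### Coset components of induced representations, and simple eigenvalues. -/

noncomputable section

open scoped TensorProduct

namespace Representation

theorem IndV.mk_mul {k G H A : Type*} [CommRing k] [Group G] [Group H] (φ : G →* H)
    [AddCommGroup A] [Module k A] (ρ : Representation k G A) (g : G) (h : H) (v : A) :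
    IndV.mk φ ρ (φ g * h) (ρ g v) = IndV.mk φ ρ h v := by
  have := Coinvariants.mk_self_apply (tprod ((leftRegular k H).comp φ) ρ) g
    (MonoidAlgebra.single h (1 : k) ⊗ₜ[k] v)
  simpa using this

variable {k G A : Type*} [CommRing k] [Group G] {H : Subgroup G} [AddCommGroup A]
  [Module k A] (ρ : Representation k H A)

theorem range_mk_le_of_mem {h h' : G} (hh : h' * h⁻¹ ∈ H) :
    LinearMap.range (IndV.mk H.subtype ρ h') ≤ LinearMap.range (IndV.mk H.subtype ρ h) := by
  rintro _ ⟨v, rfl⟩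
  refine ⟨ρ ⟨_, hh⟩⁻¹ v, ?_⟩
  rw [← IndV.mk_mul H.subtype ρ ⟨_, hh⟩ h, self_inv_apply]
  simp

open Classical in
/-- The `x`-component of the projection of an induced representation to the coset `H h`. -/
def indProjAux (h x : G) : A →ₗ[k] A :=
  if hx : x * h⁻¹ ∈ H then ρ ⟨x * h⁻¹, hx⟩⁻¹ else 0

/-- This invariance lets the projection descend to the coinvariants that define the induced module.
-/
theorem indProjAux_mul (h x : G) (g : H) (v : A) :
    indProjAux ρ h (g * x) (ρ g v) = indProjAux ρ h x v := by
  have hiff : (g * x) * h⁻¹ ∈ H ↔ x * h⁻¹ ∈ H := by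
    rw [mul_assoc]
    exact H.mul_mem_cancel_left g.2
  by_cases hx : x * h⁻¹ ∈ H
  · have hx' := hiff.mpr hx
    rw [indProjAux, indProjAux, dif_pos hx, dif_pos hx', ← Module.End.mul_apply, ← map_mul]
    congr 2
    ext
    simp [mul_assoc]
  · rw [indProjAux, indProjAux, dif_neg hx, dif_neg (mt hiff.mp hx)]
    simp

/-- The projection of an induced representation to the component of the coset `H h`. -/
def indProj (h : G) : IndV H.subtype ρ →ₗ[k] A :=
  Coinvariants.lift _ (TensorProduct.lift
    (Finsupp.linearCombination k (indProjAux ρ h) ∘ₗ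
      (MonoidAlgebra.coeffLinearEquiv k).toLinearMap)) fun g => by
    ext x v
    simpa using indProjAux_mul ρ h x g v

theorem indProj_mk (h x : G) (v : A) :
    indProj ρ h (IndV.mk H.subtype ρ x v) = indProjAux ρ h x v := by
  simp [indProj]

theorem indProj_mk_self (h : G) (v : A) : indProj ρ h (IndV.mk H.subtype ρ h v) = v := by
  rw [indProj_mk, indProjAux, dif_pos (by simp)]
  have : (⟨h * h⁻¹, by simp⟩ : H) = 1 := Subtype.ext (mul_inv_cancel h)
  rw [this, inv_one, map_one, Module.End.one_apply]

theorem indProj_mk_of_notMem {h x : G} (hx : x * h⁻¹ ∉ H) (v : A) :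
    indProj ρ h (IndV.mk H.subtype ρ x v) = 0 := by
  rw [indProj_mk, indProjAux, dif_neg hx, LinearMap.zero_apply]

end Representation

open Representation in
/-- Let `V` be a representation on an induced module which permutes the components of the cosets
in the way the induced representation does. If a power `σ ^ e` fixes all cosets and has
eigenspaces of dimension at most one in `V`, then `σ` fixes all cosets. -/
theorem conj_mem_of_eigenspace_le_one {k G A : Type*} [Field k] [IsAlgClosed k] [Group G]
    {H : Subgroup G} [AddCommGroup A] [Module k A] [FiniteDimensional k A] [Nontrivial A]
    (ρ : Representation k H A) (V : Representation k G (IndV H.subtype ρ))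
    (hV : ∀ g h v, V g (IndV.mk H.subtype ρ h v) ∈
      LinearMap.range (IndV.mk H.subtype ρ (h * g⁻¹)))
    (σ : G) (e : ℕ) (he : ∀ h : G, h * σ ^ e * h⁻¹ ∈ H)
    (heig : ∀ (μ : k) (w w' : IndV H.subtype ρ), V (σ ^ e) w = μ • w → V (σ ^ e) w' = μ • w' →
      w ≠ 0 → ∃ c : k, c • w = w') (h : G) : h * σ * h⁻¹ ∈ H := by
  let W := LinearMap.range (IndV.mk H.subtype ρ h)
  have hinj : Function.Injective (IndV.mk H.subtype ρ h) :=
    Function.LeftInverse.injective (indProj_mk_self ρ h)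
  have : Nontrivial W := (LinearEquiv.ofInjective _ hinj).symm.toEquiv.nontrivial
  have hS : ∀ w ∈ W, V (σ ^ e) w ∈ W := by
    rintro _ ⟨v, rfl⟩
    refine range_mk_le_of_mem ρ ?_ (hV (σ ^ e) h v)
    have := H.inv_mem (he h)
    simpa [mul_assoc] using this
  obtain ⟨μ, hμ⟩ := Module.End.exists_eigenvalue ((V (σ ^ e)).restrict hS)
  obtain ⟨⟨w, hwW⟩, hw⟩ := hμ.exists_hasEigenvector
  have hw1 : V (σ ^ e) w = μ • w := congrArg Subtype.val hw.apply_eq_smul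
  have hw0 : w ≠ 0 := fun h0 => hw.2 (Subtype.ext h0)
  -- `V σ` commutes with `V (σ ^ e)`, so `V σ w` lies in the same eigenspace as `w`.
  obtain ⟨c, hc⟩ := heig μ w (V σ w) hw1 (by
    rw [← Module.End.mul_apply, ← map_mul, ← pow_succ, pow_succ', map_mul, Module.End.mul_apply,
      hw1, map_smul]) hw0
  have hc0 : c ≠ 0 := by
    rintro rfl
    refine hw0 ?_
    rw [← V.inv_self_apply σ w, ← hc]
    simp
  obtain ⟨v, rfl⟩ := hwW
  obtain ⟨v', hv'⟩ := hV σ h v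
  by_contra hnot
  refine hw0 ?_
  have h1 : h * σ⁻¹ * h⁻¹ ∉ H := fun h2 => hnot (by simpa [mul_assoc] using H.inv_mem h2)
  -- If `σ` moved the coset `H h`, the projection to that component would kill `V σ w = c • w`,
  -- although it recovers `v` from `w`.
  have h2 := indProj_mk_of_notMem ρ h1 v'
  rw [hv', ← hc, map_smul, indProj_mk_self] at h2
  rw [(smul_eq_zero.mp h2).resolve_left hc0, map_zero]

/-- A block upper triangular endomorphism whose diagonal blocks are diagonal, with distinct
entries, has eigenspaces of dimension at most one. -/
theorem exists_smul_eq_of_blockTriangular {k V : Type*} [Field k] [AddCommGroup V] [Module k V]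
    {s : ℕ} {r : Fin s → ℕ} (b : Module.Basis ((i : Fin s) × Fin (r i)) k V) (f : V →ₗ[k] V)
    (hf : (LinearMap.toMatrix b b f).BlockTriangular Sigma.fst)
    (d : ((i : Fin s) × Fin (r i)) → k) (hd : Function.Injective d)
    (hdiag : ∀ i : Fin s,
      Matrix.of (fun j j' : Fin (r i) => LinearMap.toMatrix b b f ⟨i, j⟩ ⟨i, j'⟩) =
        Matrix.diagonal fun j => d ⟨i, j⟩)
    (μ : k) (w w' : V) (hw : f w = μ • w) (hw' : f w' = μ • w') (hw0 : w ≠ 0) :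
    ∃ c : k, c • w = w' := by
  have : FiniteDimensional k V := Module.Finite.of_basis b
  -- In the lexicographic order, block triangularity with diagonal blocks becomes upper
  -- triangularity, so the characteristic polynomial is read off the diagonal.
  let b' : Module.Basis (Σₗ i : Fin s, Fin (r i)) k V := b.reindex toLex
  have hM (p q : (i : Fin s) × Fin (r i)) :
      LinearMap.toMatrix b' b' f (toLex p) (toLex q) = LinearMap.toMatrix b b f p q := by
    simp [LinearMap.toMatrix_apply, b']
  have hdiag' (i : Fin s) (j j' : Fin (r i)) : LinearMap.toMatrix b b f ⟨i, j⟩ ⟨i, j'⟩ =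
      (Matrix.diagonal fun j => d ⟨i, j⟩) j j' := congrFun (congrFun (hdiag i) j) j'
  have htri : (LinearMap.toMatrix b' b' f).IsUpperTriangular := by
    intro p q hpq
    obtain ⟨p, rfl⟩ := toLex.surjective p
    obtain ⟨q, rfl⟩ := toLex.surjective q
    rw [hM]
    rcases Sigma.Lex.lt_def.mp hpq with hlt | ⟨heq, hlt⟩
    · exact hf hlt
    · obtain ⟨i, j⟩ := p
      obtain ⟨i', j'⟩ := q
      obtain rfl : i' = i := heq
      exact (hdiag' i' j j').trans (Matrix.diagonal_apply_ne _ (ne_of_gt hlt))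
  have hchar : f.charpoly = ∏ p, (Polynomial.X - Polynomial.C (d (ofLex p))) := by
    rw [← LinearMap.charpoly_toMatrix f b', Matrix.charpoly_of_isUpperTriangular _ htri]
    refine Finset.prod_congr rfl fun p _ => ?_
    obtain ⟨⟨i, j⟩, rfl⟩ := toLex.surjective p
    rw [hM, hdiag', Matrix.diagonal_apply_eq]
    rfl
  have hrank : Module.finrank k (Module.End.eigenspace f μ) ≤ 1 := by
    refine (LinearMap.finrank_eigenspace_le f μ).trans
      (Polynomial.rootMultiplicity_le_one_of_separable ?_ μ)
    rw [hchar]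
    exact Polynomial.separable_prod_X_sub_C_iff.mpr (hd.comp ofLex.injective)
  obtain ⟨v, hv⟩ := finrank_le_one_iff.mp hrank
  obtain ⟨c, hc⟩ := hv ⟨w, Module.End.mem_eigenspace_iff.mpr hw⟩
  obtain ⟨c', hc'⟩ := hv ⟨w', Module.End.mem_eigenspace_iff.mpr hw'⟩
  have h1 : c • (v : V) = w := congrArg Subtype.val hc
  have h2 : c' • (v : V) = w' := congrArg Subtype.val hc'
  have hc0 : c ≠ 0 := by
    rintro rfl
    exact hw0 (by rw [← h1, zero_smul])
  exact ⟨c' / c, by rw [← h1, ← h2, smul_smul, div_mul_cancel₀ _ hc0]⟩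

end

/-! ### Inertia fixes all cosets. -/

noncomputable section

namespace RegularGalois

variable {ℓ : ℕ} [Fact ℓ.Prime]

theorem pow_factorial_mem_of_index_le {G : Type*} [Group G] {H : Subgroup G} (hH : H.index ≠ 0)
    {n : ℕ} (hn : H.index ≤ n) (g : G) : g ^ n.factorial ∈ H := by
  obtain ⟨c, hc0, hcle, hc⟩ := Subgroup.exists_pow_mem_of_index_ne_zero hH g
  obtain ⟨q, hq⟩ := Nat.dvd_factorial hc0 (hcle.trans hn)
  rw [hq, pow_mul]
  exact H.pow_mem hc q

theorem subsingleton_indV {k G A : Type*} [CommRing k] [Group G] {H : Subgroup G}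
    [AddCommGroup A] [Module k A] [Subsingleton A] (ρ : Representation k H A) :
    Subsingleton (Representation.IndV H.subtype ρ) := by
  have h : (LinearMap.id : Representation.IndV H.subtype ρ →ₗ[k] _) = 0 :=
    Representation.IndV.hom_ext _ _ fun h => LinearMap.ext fun v => by
      rw [Subsingleton.elim v 0, map_zero, map_zero]
  exact subsingleton_of_forall_eq 0 fun x => DFunLike.congr_fun h x

/-- If a twist of an induced representation is regular with small tame inertia weights, then
inertia fixes all the cosets of the subgroup from which the representation is induced. -/
theorem restrictGQ_mem_normalCore {n m k : ℕ} (hℓ : k * n.factorial + 1 < ℓ)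
    (ι : ℕ+ → (IsLocalRing.ResidueField (Zbar ℓ) →+* Fbar ℓ))
    (j : AlgebraicClosure ℚ →+* PadicAlgCl ℓ) {H : Subgroup GQ} (hH : H.index ≠ 0)
    (hn : H.index * m = n) (ρ : Representation (Fbar ℓ) H (Fin m → Fbar ℓ))
    (χ : GQ →* (Fbar ℓ)ˣ)
    (h : IsGlobalRegularWithWeightsAtMost ℓ ι j (twist χ (ρ.ind H.subtype)) k) :
    ∀ σ ∈ inertia ℓ, restrictGQ ℓ j σ ∈ H.normalCore := by
  obtain ⟨S, ⟨s, r, a, b, hs, -, hinj, hS, hσ⟩, hk⟩ := h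
  have hm : m ≠ 0 := by
    -- For `m = 0` the induced module is zero, but `1 ≤ s` with nonempty blocks gives it a basis
    -- vector.
    rintro rfl
    have := subsingleton_indV ρ
    exact b.ne_zero ⟨⟨0, hs⟩, ⟨0, (r _).pos⟩⟩ (Subsingleton.elim _ _)
  have : NeZero m := ⟨hm⟩
  have hle : H.index ≤ n := hn ▸ Nat.le_mul_of_pos_right _ (Nat.pos_of_ne_zero hm)
  have ha (i : Fin s) (t : Fin (r i)) : n.factorial * a i t + 1 < ℓ := by
    have h1 : a i t ≤ k := hk _ (by
      rw [← Finset.mem_coe, hS]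
      exact ⟨⟨i, t⟩, rfl⟩)
    have h2 := Nat.mul_le_mul_left n.factorial h1
    rw [mul_comm n.factorial k] at h2
    omega
  let R : ℕ+ := ∏ i, r i
  let ψ := fundamentalCharacter ℓ R (ι R)
  have key (σ : inertia ℓ) (hord : orderOf (ψ σ) = ℓ ^ (R : ℕ) - 1) :
      restrictGQ ℓ j σ ∈ H.normalCore := by
    let V := twist χ (ρ.ind H.subtype)
    refine conj_mem_of_eigenspace_le_one ρ V (fun g x v => ?_) (restrictGQ ℓ j σ) n.factorial
      (fun x => ?_) (fun μ w w' hw hw' hw0 => ?_)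
    · refine ⟨(χ g : Fbar ℓ) • v, ?_⟩
      rw [map_smul, ← Representation.ind_mk]
      rfl
    · rw [← conj_pow]
      exact pow_factorial_mem_of_index_le hH hle _
    · rw [← map_pow] at hw hw'
      obtain ⟨htri, hdiag⟩ := hσ (σ ^ n.factorial)
      refine exists_smul_eq_of_blockTriangular b _ htri
        (fun p => (((fundamentalCharacter ℓ (r p.1) (ι (r p.1)) σ ^
          ((∑ t : Fin (r p.1), a p.1 t * ℓ ^ (t : ℕ)) * ℓ ^ (p.2 : ℕ))) ^ n.factorial :
            (Fbar ℓ)ˣ) : Fbar ℓ))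
        (Units.val_injective.comp (injective_fundamentalCharacter_pow ι r a n.factorial_pos ha
          hinj R (fun i => Finset.dvd_prod_of_mem r (Finset.mem_univ i)) σ hord))
        (fun i => ?_) μ w w' hw hw' hw0
      rw [hdiag i]
      congr 1
      funext t
      rw [map_pow]
      push_cast
      rw [← pow_mul, ← pow_mul, mul_comm]
  obtain ⟨σ, hord, hgen⟩ := exists_orderOf_fundamentalCharacter R (ι R)
  intro τ hτ
  obtain ⟨i, hi⟩ := hgen ⟨τ, hτ⟩
  have h1 := key σ hord
  -- The factor `σ ^ (-i) * τ` is in the kernel of `ψ`, so the product has the same value as `σ` and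
  -- `key` applies. Combining it with powers of `σ` recovers `τ`.
  have h2 := key (σ * ((σ ^ i)⁻¹ * ⟨τ, hτ⟩)) (by
    rw [map_mul, map_mul, map_inv, map_pow]
    simp only [ψ]
    rw [hi, inv_mul_cancel, mul_one, hord])
  have h3 := H.normalCore.mul_mem (H.normalCore.pow_mem h1 i)
    (H.normalCore.mul_mem (H.normalCore.inv_mem h1) h2)
  simpa using h3

end RegularGalois

end

/-! ### From trivial inertia to unramifiedness. -/

noncomputable section

open scoped Pointwise

/-- If `x` lies in the square of a prime ideal `P` of a Dedekind domain, then its valuation is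
at least twice the valuation of some element of `P`. -/
theorem exists_mul_sq_eq_sq_mul {R : Type*} [CommRing R] [IsDedekindDomain R] {P : Ideal R}
    [hP : P.IsPrime] (hP0 : P ≠ ⊥) {x : R} (hx : x ∈ P ^ 2) :
    ∃ π ∈ P, ∃ c ∉ P, ∃ d, x * c ^ 2 = π ^ 2 * d := by
  obtain ⟨π, hπ, hπ2⟩ :=
    SetLike.exists_of_lt (Ideal.pow_right_strictAnti P hP0 hP.ne_top one_lt_two)
  replace hπ : π ∈ P := by simpa using hπ
  obtain ⟨J, hJ⟩ := Ideal.dvd_span_singleton.mpr hπ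
  -- The element `π` lies in `P` but not in `P ^ 2`, so the cofactor `J` of `P` in the ideal `(π)`
  -- is not contained in `P`. A `c` in `J` outside `P` clears the other primes of `(π)`.
  have hJP : ¬ J ≤ P := fun hle => hπ2 (by
    change π ∈ P ^ 2
    rw [← Ideal.span_singleton_le_iff_mem, hJ, pow_two]
    exact Ideal.mul_mono_right hle)
  obtain ⟨c, hcJ, hcP⟩ := SetLike.not_le_iff_exists.mp hJP
  have hmem : x * c ^ 2 ∈ Ideal.span {π ^ 2} := by
    rw [← Ideal.span_singleton_pow, hJ, mul_pow]
    exact Ideal.mul_mem_mul hx (Ideal.pow_mem_pow hcJ 2)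
  obtain ⟨d, hd⟩ := Ideal.mem_span_singleton'.mp hmem
  exact ⟨π, hπ, c, hcP, d, by rw [← hd, mul_comm]⟩

namespace RegularGalois

open NumberField

variable {ℓ : ℕ} [Fact ℓ.Prime]

theorem mem_Zbar_of_isIntegral {x : PadicAlgCl ℓ} (hx : IsIntegral ℤ x) : x ∈ Zbar ℓ := by
  obtain ⟨y, hy⟩ := IsIntegrallyClosed.isIntegral_iff.mp (hx.tower_top (A := Zbar ℓ))
  exact hy ▸ y.2

/-- An embedding of `ℚ̄` into `ℚ̄_ℓ` maps algebraic integers to integral elements. -/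
def integersToZbar (j : AlgebraicClosure ℚ →+* PadicAlgCl ℓ) :
    𝓞 (AlgebraicClosure ℚ) →+* Zbar ℓ :=
  (j.comp (algebraMap (𝓞 (AlgebraicClosure ℚ)) (AlgebraicClosure ℚ))).codRestrict
    (Zbar ℓ).toSubring fun x => mem_Zbar_of_isIntegral (x.isIntegral_coe.map (j.toIntAlgHom))

/-- The prime of the ring of all algebraic integers cut out by an embedding of `ℚ̄` in `ℚ̄_ℓ`. -/
def primeOfEmbedding (j : AlgebraicClosure ℚ →+* PadicAlgCl ℓ) :
    Ideal (𝓞 (AlgebraicClosure ℚ)) :=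
  (IsLocalRing.maximalIdeal (Zbar ℓ)).comap (integersToZbar j)

instance (j : AlgebraicClosure ℚ →+* PadicAlgCl ℓ) : (primeOfEmbedding j).IsPrime :=
  Ideal.comap_isPrime _ _

theorem mem_primeOfEmbedding_iff (j : AlgebraicClosure ℚ →+* PadicAlgCl ℓ)
    (x : 𝓞 (AlgebraicClosure ℚ)) : x ∈ primeOfEmbedding j ↔ ‖j x‖ < 1 :=
  mem_maximalIdeal_Zbar_iff _

theorem under_eq_span_of_mem {R : Type*} [CommRing R] {P : Ideal R} [P.IsPrime]
    (h : (ℓ : R) ∈ P) : P.under ℤ = Ideal.span {(ℓ : ℤ)} := by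
  have hℓ : Prime (ℓ : ℤ) := Nat.prime_iff_prime_int.mp Fact.out
  have hmax : (Ideal.span {(ℓ : ℤ)}).IsMaximal :=
    ((Ideal.span_singleton_prime hℓ.ne_zero).mpr hℓ).isMaximal
      (by simpa using hℓ.ne_zero)
  refine (hmax.eq_of_le (Ideal.IsPrime.under ℤ P).ne_top ?_).symm
  rw [Ideal.span_singleton_le_iff_mem, Ideal.mem_comap]
  simpa using h

/-- A Galois-invariant algebraic integer is rational, hence in `ℤ`. This is what makes `G_ℚ`
transitive on the primes above `ℓ`. -/
instance isInvariant_integers : Algebra.IsInvariant ℤ (𝓞 (AlgebraicClosure ℚ)) GQ := by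
  refine ⟨fun x hx => ?_⟩
  have h1 : (x : AlgebraicClosure ℚ) ∈ (⊥ : IntermediateField ℚ (AlgebraicClosure ℚ)) := by
    rw [InfiniteGalois.mem_bot_iff_fixed]
    intro σ
    exact congrArg Subtype.val (hx σ)
  obtain ⟨q, hq⟩ := IntermediateField.mem_bot.mp h1
  have h2 : IsIntegral ℤ q := by
    rw [← isIntegral_algebraMap_iff (algebraMap ℚ (AlgebraicClosure ℚ)).injective, hq]
    exact x.isIntegral_coe
  obtain ⟨z, rfl⟩ := IsIntegrallyClosed.isIntegral_iff.mp h2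
  refine ⟨z, RingOfIntegers.ext ?_⟩
  rw [← hq]
  simp

/-- Every prime above `ℓ` of the ring of all algebraic integers comes from an embedding that is
conjugate to a given one. -/
theorem exists_eq_smul_primeOfEmbedding (j : AlgebraicClosure ℚ →+* PadicAlgCl ℓ)
    (P : Ideal (𝓞 (AlgebraicClosure ℚ))) [P.IsPrime] (hP : (ℓ : 𝓞 (AlgebraicClosure ℚ)) ∈ P) :
    ∃ g : GQ, P = g • primeOfEmbedding j := by
  let : TopologicalSpace (𝓞 (AlgebraicClosure ℚ)) := ⊥
  have : DiscreteTopology (𝓞 (AlgebraicClosure ℚ)) := ⟨rfl⟩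
  have : ContinuousSMul GQ (𝓞 (AlgebraicClosure ℚ)) := by
    rw [continuousSMul_iff_stabilizer_isOpen]
    intro x
    convert! stabilizer_isOpen_of_isIntegral (K := ℚ) (x : AlgebraicClosure ℚ) using 1
    ext τ
    exact Subtype.ext_iff
  have hj : (ℓ : 𝓞 (AlgebraicClosure ℚ)) ∈ primeOfEmbedding j := by
    have hℓ : j ((ℓ : 𝓞 (AlgebraicClosure ℚ)) : AlgebraicClosure ℚ) = ℓ := by simp
    rw [mem_primeOfEmbedding_iff, hℓ, norm_natCast_prime]
    exact inv_lt_one_of_one_lt₀ (by exact_mod_cast (Fact.out : ℓ.Prime).one_lt)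
  exact Algebra.IsInvariant.exists_smul_of_under_eq_of_profinite (A := ℤ) (G := GQ) _ _
    ((under_eq_span_of_mem hj).trans (under_eq_span_of_mem hP).symm)

/-- If inertia at `ℓ` acts trivially on all conjugates of a number field, then the number field
is unramified at `ℓ`. -/
theorem isUnramifiedIn_of_restrictGQ_mem_normalCore (j : AlgebraicClosure ℚ →+* PadicAlgCl ℓ)
    (K : IntermediateField ℚ (AlgebraicClosure ℚ)) [FiniteDimensional ℚ K]
    (h : ∀ σ ∈ inertia ℓ, restrictGQ ℓ j σ ∈ K.fixingSubgroup.normalCore) :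
    Algebra.IsUnramifiedIn (𝓞 K) (Ideal.span {(ℓ : ℤ)}) := by
  have : NumberField K := { }
  rw [Algebra.isUnramifiedIn_iff_forall_ramificationIdx_eq_one]
  intro P hP hPℓ
  have hℓP : (ℓ : 𝓞 K) ∈ P := by
    have h1 : (ℓ : ℤ) ∈ P.under ℤ := by
      rw [← hPℓ.over]
      exact Ideal.mem_span_singleton_self _
    simpa [Ideal.mem_comap] using h1
  have hℓ0 : (ℓ : 𝓞 K) ≠ 0 := by exact_mod_cast (Fact.out : ℓ.Prime).ne_zero
  have hP0 : P ≠ ⊥ := fun h0 => hℓ0 (by simpa [h0] using hℓP)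
  let f : 𝓞 K →+* 𝓞 (AlgebraicClosure ℚ) := algebraMap (𝓞 K) (𝓞 (AlgebraicClosure ℚ))
  have hker : RingHom.ker f ≤ P := by
    rw [(RingHom.injective_iff_ker_eq_bot f).mp (FaithfulSMul.algebraMap_injective _ _)]
    exact bot_le
  obtain ⟨P', hP', hP'P⟩ := Ideal.exists_ideal_over_prime_of_isIntegral_of_isDomain P hker
  have hℓP' : (ℓ : 𝓞 (AlgebraicClosure ℚ)) ∈ P' := by
    rw [← hP'P, Ideal.mem_comap, map_natCast] at hℓP
    exact hℓP
  obtain ⟨g, hg⟩ := exists_eq_smul_primeOfEmbedding j P' hℓP'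
  -- Composing with `g⁻¹` makes the embedding cut out the given prime `P`. Since `g` varies with
  -- `P`, inertia has to lie in the normal core.
  let φ : 𝓞 K → PadicAlgCl ℓ := fun x => j (g⁻¹ (x : K))
  have hφP (x : 𝓞 K) : x ∈ P ↔ ‖φ x‖ < 1 := by
    rw [← hP'P, Ideal.mem_comap, hg, Ideal.mem_pointwise_smul_iff_inv_smul_mem,
      mem_primeOfEmbedding_iff]
    rfl
  have hφ1 (x : 𝓞 K) : ‖φ x‖ ≤ 1 := norm_coe_Zbar_le_one (integersToZbar j (g⁻¹ • f x))
  have hφfix (x : 𝓞 K) : ∀ σ ∈ inertia ℓ, σ (φ x) = φ x := by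
    intro σ hσ
    have h1 := h σ hσ g ⟨_, (x : K).2⟩
    have h2 : restrictGQ ℓ j σ (g⁻¹ (x : K)) = g⁻¹ (x : K) := g.injective (by simpa using! h1)
    rw [← restrictGQ_spec, h2]
  have hmap : (Ideal.span {(ℓ : ℤ)}).map (algebraMap ℤ (𝓞 K)) ≤ P := by
    rw [Ideal.map_span, Set.image_singleton, Ideal.span_singleton_le_iff_mem]
    simpa using hℓP
  rw [← Ideal.ramificationIdx'_eq_ramificationIdx (Ideal.span {(ℓ : ℤ)}) P, ← not_ne_iff,
    Ideal.ramificationIdx'_ne_one_iff hmap]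
  swap
  · simpa using (Fact.out : ℓ.Prime).ne_zero
  intro hsq
  have hℓsq : (ℓ : 𝓞 K) ∈ P ^ 2 := by
    simpa using hsq (Ideal.mem_map_of_mem _ (Ideal.mem_span_singleton_self (ℓ : ℤ)))
  obtain ⟨π, hπ, c, hc, d, heq⟩ := exists_mul_sq_eq_sq_mul hP0 hℓsq
  have hπ1 := norm_le_inv_of_fixed_by_inertia (hφfix π) ((hφP π).mp hπ)
  have hc1 : ‖φ c‖ = 1 := le_antisymm (hφ1 c) (not_lt.mp (mt (hφP c).mpr hc))
  have heq' : (ℓ : PadicAlgCl ℓ) * φ c ^ 2 = φ π ^ 2 * φ d := by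
    have h1 := congrArg (fun x : 𝓞 K => φ x) heq
    simpa [φ] using h1
  have hnorm := congrArg norm heq'
  rw [norm_mul, norm_mul, norm_pow, norm_pow, hc1, norm_natCast_prime, one_pow, mul_one] at hnorm
  have hℓ1 : (ℓ : ℝ)⁻¹ < 1 :=
    inv_lt_one_of_one_lt₀ (by exact_mod_cast (Fact.out : ℓ.Prime).one_lt)
  have hℓ2 : 0 < (ℓ : ℝ)⁻¹ := inv_pos.mpr (by exact_mod_cast (Fact.out : ℓ.Prime).pos)
  have h1 : ‖φ π‖ ^ 2 * ‖φ d‖ ≤ ((ℓ : ℝ)⁻¹) ^ 2 * 1 :=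
    mul_le_mul (pow_le_pow_left₀ (norm_nonneg _) hπ1 2) (hφ1 d) (norm_nonneg _) (by positivity)
  -- The valuation equation would give `1/ℓ ≤ (1/ℓ)^2`, contradicting `0 < 1/ℓ < 1`.
  nlinarith

end RegularGalois

end

open RegularGalois Topology in
theorem proposition3p4
    (n m k : ℕ) (a : ℤ) (ℓ : ℕ) [Fact ℓ.Prime] (hℓ : k * n.factorial + 1 < ℓ)
    -- the choice of a fundamental character of each niveau, and of `G_{ℚ_ℓ} → G_ℚ`
    (ι : ℕ+ → (IsLocalRing.ResidueField (Zbar ℓ) →+* Fbar ℓ))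
    (j : AlgebraicClosure ℚ →+* PadicAlgCl ℓ)
    (K : IntermediateField ℚ (AlgebraicClosure ℚ)) [FiniteDimensional ℚ K]
    (hn : Module.finrank ℚ K * m = n)
    (ρ : K.fixingSubgroup →* GL (Fin m) (Fbar ℓ))
    -- `ρ` is continuous for the discrete topology on its target
    (hρ : Continuous[inferInstance, ⊥] ρ)
    (h : IsGlobalRegularWithWeightsAtMost ℓ ι j
      (twist (cyclo ℓ ^ a) ((toRep ρ).ind K.fixingSubgroup.subtype)) k) :
    Algebra.IsUnramifiedIn (NumberField.RingOfIntegers K) (Ideal.span {(ℓ : ℤ)}) := by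
  have hindex : K.fixingSubgroup.index = Module.finrank ℚ K :=
    (IntermediateField.finrank_eq_fixingSubgroup_index (E' := AlgebraicClosure ℚ) K).symm
  exact isUnramifiedIn_of_restrictGQ_mem_normalCore j K
    (restrictGQ_mem_normalCore hℓ ι j (hindex ▸ Module.finrank_pos.ne') (hindex ▸ hn) (toRep ρ)
      (cyclo ℓ ^ a) h)
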